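/- Let $d\ge 1$, let $\sigma\ge d+1$ be an integer and let $J=\mathrm{diag}(1,-1,\dots,-1)$ be of size $d+1$. Let $g=\begin{pmatrix} a & \mathbf b^t\\ \mathbf c & D\end{pmatrix}\in \mathrm{SU}(1,d)$, i.e. $g$ is a complex $(d+1)\times(d+1)$ matrix with $\det g=1$ and $g^\dagger J g=J$, where $a\in\mathbb C$, $\mathbf b,\mathbf c\in\mathbb C^d$ and $D$ is a $d\times d$ matrix; assume $a\ne0$ and $b_i,c_i\neq 0$ for $i=1,\dots,d$. Put $$p_i=\frac{b_i}{a},\qquad \tilde p_i=\frac{c_i}{a},\qquad U_{i,j}=\frac{a\,D_{j,i}}{b_i c_j}\qquad (1\le i,j\le d),$$ and let $p_0\in\mathbb C$ be such that $|p_0|^2=|a|^{-2}$. For $\mathbf x\in\mathbb C^d$ write $|\mathbf x|=x_1+\dots+x_d$. For $\mathbf m,\mathbf n\in\mathbb N_0^d$ let $M_{\mathbf m}(\mathbf n)=M_{\mathbf m}(\mathbf n;U,\sigma)$ be the multivariate Meixner polynomials, which are defined by the expansion, for $\mathbf t\in\mathbb C^d$ near $0$, $$\Big(1-\sum_{j=1}^d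 t_j\Big)^{-\sigma-|\mathbf n|}\prod_{i=1}^d\Big(1-\sum_{j=1}^d U_{i,j}t_j\Big)^{n_i}=\sum_{\mathbf m\in\mathbb N_0^d}\frac{(\sigma)_{|\mathbf m|}}{m_1!\cdots m_d!}\,M_{\mathbf m}(\mathbf n;U,\sigma)\,t_1^{m_1}\cdots t_d^{m_d},$$ where $(\sigma)_k=\sigma(\sigma+1)\cdots(\sigma+k-1)$. Let $\mathbf v_i$ denote the $i$-th standard basis vector of $\mathbb C^d$. Then for all $\mathbf m,\mathbf n\in\mathbb N_0^d$ and $k=1,\dots,d$, $$\begin{aligned} \left|\frac{p_0}{p_k}\right|^2 n_k\, M_{\mathbf m}(\mathbf n)={}&\Big(\sigma+|\mathbf m|+\sum_{i=1}^d|U_{k,i}\tilde p_i|^2m_i\Big)M_{\mathbf m}(\mathbf n)+\sum_{\substack{i,j=1\\ i\ne j}}^d\overline{U_{k,i}}\,U_{k,j}\,|\tilde p_i|^2\,m_j\,M_{\mathbf m-\mathbf v_j+\mathbf v_i}(\mathbf n)\\ &-\sum_{i=1}^dU_{k,i}\,m_i\,M_{\mathbf m-\mathbf v_i}(\mathbf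 n)-(\sigma+|\mathbf m|)\sum_{i=1}^d\overline{U_{k,i}}\,|\tilde p_i|^2\,M_{\mathbf m+\mathbf v_i}(\mathbf n). \end{aligned}$$ Here a term that contains an $M$ whose index has a negative entry is $0$ (its factor $m_i$ or $m_j$ vanishes). -/

import Mathlib

open scoped Matrix

/-- The diagonal matrix `J = diag(1, -1, …, -1)` of size `d + 1`. -/
def lorentzJ (d : ℕ) : Matrix (Fin (d + 1)) (Fin (d + 1)) ℂ :=
  Matrix.diagonal (Fin.cons 1 (fun _ => -1))

/-- The group `SU(1,d)`: the `g ∈ SL(d+1, ℂ)` with `g† J g = J`. -/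
def SU1 (d : ℕ) : Subgroup (Matrix.SpecialLinearGroup (Fin (d + 1)) ℂ) where
  carrier := {g | g.valᴴ * lorentzJ d * g.val = lorentzJ d}
  one_mem' := by simp
  mul_mem' := by
    intro g h hg hh
    simp only [Set.mem_ofPred_eq] at hg hh ⊢
    calc (g * h).valᴴ * lorentzJ d * (g * h).val
        = h.valᴴ * (g.valᴴ * lorentzJ d * g.val) * h.val := by
          simp [Matrix.SpecialLinearGroup.coe_mul, Matrix.conjTranspose_mul, Matrix.mul_assoc]
      _ = lorentzJ d := by rw [hg, hh]
  inv_mem' := by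
    intro g hg
    simp only [Set.mem_ofPred_eq] at hg ⊢
    have h1 : g.val * (g⁻¹).val = 1 := by
      rw [← Matrix.SpecialLinearGroup.coe_mul, mul_inv_cancel,
        Matrix.SpecialLinearGroup.coe_one]
    have h2 : (g⁻¹).valᴴ * g.valᴴ = 1 := by
      rw [← Matrix.conjTranspose_mul, h1, Matrix.conjTranspose_one]
    calc (g⁻¹).valᴴ * lorentzJ d * (g⁻¹).val
        = (g⁻¹).valᴴ * (g.valᴴ * lorentzJ d * g.val) * (g⁻¹).val := by rw [hg]
      _ = ((g⁻¹).valᴴ * g.valᴴ) * lorentzJ d * (g.val * (g⁻¹).val) := by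
          simp only [Matrix.mul_assoc]
      _ = lorentzJ d := by rw [h1, h2, one_mul, mul_one]

namespace SU1

variable {d : ℕ}

/-- The blocks of `g = (a, bᵗ; c, D)`. -/
def a (g : SU1 d) : ℂ := g.val.val 0 0

def b (g : SU1 d) (i : Fin d) : ℂ := g.val.val 0 i.succ

def c (g : SU1 d) (i : Fin d) : ℂ := g.val.val i.succ 0

def D (g : SU1 d) : Matrix (Fin d) (Fin d) ℂ := fun i j => g.val.val i.succ j.succ

/-- `p_i = b_i / a`. -/
noncomputable def p (g : SU1 d) (i : Fin d) : ℂ := b g i / a g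

/-- `p̃_i = c_i / a`. -/
noncomputable def pTilde (g : SU1 d) (i : Fin d) : ℂ := c g i / a g

/-- `U_{i,j} = a D_{j,i} / (b_i c_j)`. -/
noncomputable def U (g : SU1 d) : Matrix (Fin d) (Fin d) ℂ :=
  fun i j => a g * D g j i / (b g i * c g j)

end SU1

/-- The generating function
`G(x, t, U, β) = (1 - ∑ⱼ tⱼ)^(-β - |x|) ∏ᵢ (1 - ∑ⱼ Uᵢⱼ tⱼ)^(xᵢ)`, with principal powers. -/
noncomputable def meixnerGen {d : ℕ} (x : Fin d → ℂ) (U : Matrix (Fin d) (Fin d) ℂ) (β : ℂ)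
    (t : Fin d → ℂ) : ℂ :=
  (1 - ∑ j, t j) ^ (-β - ∑ i, x i) * ∏ i, (1 - ∑ j, U i j * t j) ^ (x i)

/-- The complex partial derivative in the `i`-th coordinate. -/
noncomputable def partialDeriv {d : ℕ} (i : Fin d) (F : (Fin d → ℂ) → ℂ) : (Fin d → ℂ) → ℂ :=
  fun t => fderiv ℂ F t (Pi.single i 1)

/-- The iterated partial derivative `∂₁^{m₁} ⋯ ∂_d^{m_d} F`. -/
noncomputable def multiPartialDeriv {d : ℕ} (m : Fin d → ℕ) (F : (Fin d → ℂ) → ℂ) :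
    (Fin d → ℂ) → ℂ :=
  (List.finRange d).foldr (fun i H => (partialDeriv i)^[m i] H) F

/-- The coefficient of `t^m` in the power series of `F` at `0`, namely `(∂^m F)(0) / m!`. -/
noncomputable def taylorCoeff {d : ℕ} (m : Fin d → ℕ) (F : (Fin d → ℂ) → ℂ) : ℂ :=
  multiPartialDeriv m F 0 / ∏ i, ((m i).factorial : ℂ)

/-- The multivariate Meixner polynomial `M_m(x; U, β)`, defined by the expansion
`G(x, t, U, β) = ∑_m (β)_{|m|} / m! * M_m(x; U, β) t^m` for `t` near `0`:
it is the `m`-th power series coefficient of the generating function,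
divided by `(β)_{|m|} / m!`. Here `(β)_k = β (β + 1) ⋯ (β + k - 1)`. -/
noncomputable def meixner {d : ℕ} (m : Fin d → ℕ) (x : Fin d → ℂ)
    (U : Matrix (Fin d) (Fin d) ℂ) (β : ℂ) : ℂ :=
  taylorCoeff m (meixnerGen x U β) /
    ((ascPochhammer ℂ (∑ i, m i)).eval β / ∏ i, ((m i).factorial : ℂ))

/-- The Meixner polynomials `M_m(n) = M_m(n; U, σ)` attached to `g`. -/
noncomputable def SU1.M {d : ℕ} (g : SU1 d) (σ : ℕ) (m n : Fin d → ℕ) : ℂ :=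
  meixner m (fun i => (n i : ℂ)) (SU1.U g) (σ : ℂ)

/-!
The recurrence is the coefficient form of a first-order differential equation in `t` for the
generating function `G(t) = (1 - S)^(-σ - |n|) ∏ₗ (1 - Lₗ)^(nₗ)`, where `S = ∑ⱼ tⱼ` and
`Lₗ = ∑ⱼ Uₗⱼ tⱼ`. Put `wᵢ = conj(Uₖᵢ) |p̃ᵢ|²` and `θ = ∑ⱼ tⱼ ∂ⱼ`. Logarithmic differentiation gives
`(σ + θ - ∑ᵢ wᵢ ∂ᵢ) G / G = (σ + |n|) (1 - ∑ᵢ wᵢ) / (1 - S) - ∑ₗ nₗ (1 - ∑ᵢ wᵢ Uₗᵢ) / (1 - Lₗ)`.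
Pseudo-orthogonality of the columns of `g` says exactly that `∑ᵢ wᵢ = 1` (columns `0` and `k`,
`SU1.sum_weight`) and `∑ᵢ wᵢ Uₗᵢ = 1 + δₖₗ / |bₖ|²` (columns `k` and `l`, `SU1.sum_weight_mul_U`),
so only the term `l = k` survives, and
`(1 - Lₖ) (σ + θ - ∑ᵢ wᵢ ∂ᵢ) G = nₖ |bₖ|⁻² G` (`meixnerGen_pde`), where `|bₖ|⁻² = |p₀ / pₖ|²`.

The derivatives `(∂^m G)(0)` equal `(σ)_{|m|} M_m(n)`. Applying `∂^m` at the origin to the equation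
therefore yields the recurrence, once it is known that `∂ᵢ` raises the index by `vᵢ`
(`multiPartialDeriv_partialDeriv`, which rests on the symmetry of second derivatives of analytic
functions) and that multiplication by `tⱼ` lowers it (`multiPartialDeriv_coord_mul`). Division by
`(σ)_{|m|}` is allowed because `σ > 0`.
-/

open Filter Topology

/-! ### Partial derivatives of analytic germs -/

section PartialDeriv

variable {d : ℕ} {F H : (Fin d → ℂ) → ℂ}

lemma AnalyticAt.partialDeriv {t : Fin d → ℂ} (i : Fin d) (hF : AnalyticAt ℂ F t) :
    AnalyticAt ℂ (partialDeriv i F) t :=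
  ((ContinuousLinearMap.apply ℂ ℂ (Pi.single i 1 : Fin d → ℂ)).analyticAt _).comp hF.fderiv

lemma AnalyticAt.iterate_partialDeriv {t : Fin d → ℂ} (i : Fin d) (k : ℕ)
    (hF : AnalyticAt ℂ F t) : AnalyticAt ℂ ((_root_.partialDeriv i)^[k] F) t := by
  induction k with
  | zero => exact hF
  | succ k ih => rw [Function.iterate_succ_apply']; exact ih.partialDeriv i

lemma Filter.EventuallyEq.partialDeriv {t : Fin d → ℂ} (i : Fin d) (h : F =ᶠ[𝓝 t] H) :
    partialDeriv i F =ᶠ[𝓝 t] partialDeriv i H :=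
  (h.fderiv (𝕜 := ℂ)).mono fun s hs => by simp only [_root_.partialDeriv, hs]

lemma Filter.EventuallyEq.iterate_partialDeriv {t : Fin d → ℂ} (i : Fin d) (k : ℕ)
    (h : F =ᶠ[𝓝 t] H) : (_root_.partialDeriv i)^[k] F =ᶠ[𝓝 t] (_root_.partialDeriv i)^[k] H := by
  induction k with
  | zero => exact h
  | succ k ih => simp only [Function.iterate_succ_apply']; exact ih.partialDeriv i

lemma partialDeriv_comm_apply {t : Fin d → ℂ} (i j : Fin d) (hF : AnalyticAt ℂ F t) :
    partialDeriv i (partialDeriv j F) t = partialDeriv j (partialDeriv i F) t := by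
  have hsymm : IsSymmSndFDerivAt ℂ F t := hF.contDiffAt.isSymmSndFDerivAt_of_omega
  have key : ∀ i j : Fin d, partialDeriv i (partialDeriv j F) t =
      fderiv ℂ (fderiv ℂ F) t (Pi.single i 1) (Pi.single j 1) := by
    intro i j
    unfold partialDeriv
    rw [fderiv_clm_apply hF.fderiv.differentiableAt (differentiableAt_const _)]
    simp
  rw [key, key, hsymm.eq]

lemma partialDeriv_comm {t : Fin d → ℂ} (i j : Fin d) (hF : AnalyticAt ℂ F t) :
    partialDeriv i (partialDeriv j F) =ᶠ[𝓝 t] partialDeriv j (partialDeriv i F) :=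
  hF.eventually_analyticAt.mono fun _ hs => partialDeriv_comm_apply i j hs

lemma partialDeriv_iterate_comm {t : Fin d → ℂ} (i j : Fin d) (k : ℕ) (hF : AnalyticAt ℂ F t) :
    partialDeriv i ((partialDeriv j)^[k] F) =ᶠ[𝓝 t] (partialDeriv j)^[k] (partialDeriv i F) := by
  induction k with
  | zero => exact EventuallyEq.rfl
  | succ k ih =>
    simp only [Function.iterate_succ_apply']
    exact (partialDeriv_comm i j (hF.iterate_partialDeriv j k)).trans (ih.partialDeriv j)

lemma partialDeriv_add {t : Fin d → ℂ} (i : Fin d) (hF : AnalyticAt ℂ F t)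
    (hH : AnalyticAt ℂ H t) :
    partialDeriv i (fun s => F s + H s) =ᶠ[𝓝 t]
      fun s => partialDeriv i F s + partialDeriv i H s := by
  filter_upwards [hF.eventually_analyticAt, hH.eventually_analyticAt] with s h1 h2
  unfold partialDeriv
  rw [fderiv_fun_add h1.differentiableAt h2.differentiableAt]
  rfl

lemma partialDeriv_const_mul {t : Fin d → ℂ} (i : Fin d) (z : ℂ) (hF : AnalyticAt ℂ F t) :
    partialDeriv i (fun s => z * F s) =ᶠ[𝓝 t] fun s => z * partialDeriv i F s := by
  filter_upwards [hF.eventually_analyticAt] with s h1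
  unfold partialDeriv
  rw [fderiv_const_mul h1.differentiableAt]
  rfl

lemma partialDeriv_coord_mul {t : Fin d → ℂ} (i j : Fin d) (hF : AnalyticAt ℂ F t) :
    partialDeriv i (fun s => s j * F s) =ᶠ[𝓝 t]
      fun s => s j * partialDeriv i F s + (if i = j then 1 else 0) * F s := by
  filter_upwards [hF.eventually_analyticAt] with s h1
  have hcoord : HasFDerivAt (fun s : Fin d → ℂ => s j)
      (ContinuousLinearMap.proj (R := ℂ) (φ := fun _ : Fin d => ℂ) j) s :=
    (ContinuousLinearMap.proj (R := ℂ) (φ := fun _ : Fin d => ℂ) j).hasFDerivAt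
  unfold partialDeriv
  rw [(hcoord.fun_mul h1.differentiableAt.hasFDerivAt).fderiv]
  simp [Pi.single_apply, eq_comm, mul_comm]

/-! ### Mixed partial derivatives -/

lemma analyticAt_foldr_partialDeriv {t : Fin d → ℂ} (l : List (Fin d)) (m : Fin d → ℕ)
    (hF : AnalyticAt ℂ F t) :
    AnalyticAt ℂ (l.foldr (fun i H => (partialDeriv i)^[m i] H) F) t := by
  induction l with
  | nil => exact hF
  | cons j l ih => exact ih.iterate_partialDeriv j (m j)

lemma foldr_partialDeriv_congr {t : Fin d → ℂ} (l : List (Fin d)) (m : Fin d → ℕ)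
    (h : F =ᶠ[𝓝 t] H) :
    l.foldr (fun i H => (partialDeriv i)^[m i] H) F =ᶠ[𝓝 t]
      l.foldr (fun i H => (partialDeriv i)^[m i] H) H := by
  induction l with
  | nil => exact h
  | cons j l ih => exact ih.iterate_partialDeriv j (m j)

lemma partialDeriv_foldr_comm {t : Fin d → ℂ} (l : List (Fin d)) (m : Fin d → ℕ) (i : Fin d)
    (hF : AnalyticAt ℂ F t) :
    partialDeriv i (l.foldr (fun i H => (partialDeriv i)^[m i] H) F) =ᶠ[𝓝 t]
      l.foldr (fun i H => (partialDeriv i)^[m i] H) (partialDeriv i F) := by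
  induction l with
  | nil => exact EventuallyEq.rfl
  | cons j l ih =>
    exact (partialDeriv_iterate_comm i j (m j) (analyticAt_foldr_partialDeriv l m hF)).trans
      (ih.iterate_partialDeriv j (m j))

lemma foldr_partialDeriv_add_single_of_notMem (l : List (Fin d)) (m : Fin d → ℕ) (i : Fin d)
    (hi : i ∉ l) (F : (Fin d → ℂ) → ℂ) :
    l.foldr (fun j H => (partialDeriv j)^[(m + Pi.single i 1 : Fin d → ℕ) j] H) F =
      l.foldr (fun j H => (partialDeriv j)^[m j] H) F := by
  induction l with
  | nil => rfl
  | cons j l ih =>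
    rw [List.mem_cons, not_or] at hi
    simp only [List.foldr_cons]
    rw [ih hi.2]
    simp [Ne.symm hi.1]

lemma foldr_partialDeriv_add_single {t : Fin d → ℂ} (l : List (Fin d)) (hl : l.Nodup)
    (m : Fin d → ℕ) (i : Fin d) (hi : i ∈ l) (hF : AnalyticAt ℂ F t) :
    l.foldr (fun j H => (partialDeriv j)^[(m + Pi.single i 1 : Fin d → ℕ) j] H) F =ᶠ[𝓝 t]
      l.foldr (fun j H => (partialDeriv j)^[m j] H) (partialDeriv i F) := by
  induction l with
  | nil => simp at hi
  | cons j l ih =>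
    rw [List.nodup_cons] at hl
    simp only [List.foldr_cons]
    by_cases hij : i = j
    · subst hij
      rw [foldr_partialDeriv_add_single_of_notMem l m i hl.1, Pi.add_apply, Pi.single_eq_same,
        Function.iterate_succ_apply]
      exact (partialDeriv_foldr_comm l m i hF).iterate_partialDeriv i (m i)
    · have hmj : (m + Pi.single i 1 : Fin d → ℕ) j = m j := by simp [Ne.symm hij]
      rw [hmj]
      exact (ih hl.2 ((List.mem_cons.mp hi).resolve_left hij)).iterate_partialDeriv j (m j)

lemma multiPartialDeriv_congr {t : Fin d → ℂ} (m : Fin d → ℕ) (h : F =ᶠ[𝓝 t] H) :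
    multiPartialDeriv m F t = multiPartialDeriv m H t :=
  (foldr_partialDeriv_congr _ m h).eq_of_nhds

lemma multiPartialDeriv_zero (F : (Fin d → ℂ) → ℂ) : multiPartialDeriv 0 F = F := by
  unfold multiPartialDeriv
  induction List.finRange d with
  | nil => rfl
  | cons j l ih => simp

lemma multiPartialDeriv_partialDeriv {t : Fin d → ℂ} (m : Fin d → ℕ) (i : Fin d)
    (hF : AnalyticAt ℂ F t) :
    multiPartialDeriv m (partialDeriv i F) t = multiPartialDeriv (m + Pi.single i 1) F t :=
  (foldr_partialDeriv_add_single _ (List.nodup_finRange d) m i (List.mem_finRange i)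
    hF).symm.eq_of_nhds

lemma sub_single_add_single {m : Fin d → ℕ} {i : Fin d} (hi : m i ≠ 0) :
    m - Pi.single i 1 + Pi.single i 1 = m :=
  tsub_add_cancel_of_le fun l => by
    by_cases hl : l = i
    · subst hl; simpa [Nat.one_le_iff_ne_zero] using hi
    · simp [hl]

lemma sum_add_single (m : Fin d → ℕ) (i : Fin d) :
    ∑ l, (m + Pi.single i 1 : Fin d → ℕ) l = ∑ l, m l + 1 := by
  simp [Finset.sum_add_distrib]

/-- Multi-indices are generated from `0` by adding basis vectors. -/
lemma multiIndex_induction {P : (Fin d → ℕ) → Prop} (zero : P 0)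
    (add_single : ∀ m i, P m → P (m + Pi.single i 1)) (m : Fin d → ℕ) : P m := by
  induction hN : ∑ i, m i generalizing m with
  | zero =>
    have hm : m = 0 := by
      funext i
      exact (Finset.sum_eq_zero_iff.mp hN) i (Finset.mem_univ i)
    exact hm ▸ zero
  | succ N ih =>
    obtain ⟨i, -, hi⟩ : ∃ i ∈ Finset.univ, m i ≠ 0 := by
      apply Finset.exists_ne_zero_of_sum_ne_zero
      omega
    have hm := sub_single_add_single hi
    have hs : ∑ j, (m - Pi.single i 1 : Fin d → ℕ) j = N := by
      have h := sum_add_single (m - Pi.single i 1) i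
      rw [hm] at h
      omega
    exact hm ▸ add_single _ i (ih _ hs)

lemma multiPartialDeriv_add {t : Fin d → ℂ} (m : Fin d → ℕ) (hF : AnalyticAt ℂ F t)
    (hH : AnalyticAt ℂ H t) :
    multiPartialDeriv m (fun s => F s + H s) t =
      multiPartialDeriv m F t + multiPartialDeriv m H t := by
  induction m using multiIndex_induction generalizing F H with
  | zero => simp only [multiPartialDeriv_zero]
  | add_single m i ih =>
    rw [← multiPartialDeriv_partialDeriv m i (hF.fun_add hH),
      multiPartialDeriv_congr m (partialDeriv_add i hF hH),
      ih (hF.partialDeriv i) (hH.partialDeriv i), multiPartialDeriv_partialDeriv m i hF,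
      multiPartialDeriv_partialDeriv m i hH]

lemma multiPartialDeriv_const_mul {t : Fin d → ℂ} (m : Fin d → ℕ) (z : ℂ)
    (hF : AnalyticAt ℂ F t) :
    multiPartialDeriv m (fun s => z * F s) t = z * multiPartialDeriv m F t := by
  induction m using multiIndex_induction generalizing F with
  | zero => simp only [multiPartialDeriv_zero]
  | add_single m i ih =>
    rw [← multiPartialDeriv_partialDeriv m i (analyticAt_const.fun_mul hF),
      multiPartialDeriv_congr m (partialDeriv_const_mul i z hF),
      ih (hF.partialDeriv i), multiPartialDeriv_partialDeriv m i hF]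

lemma multiPartialDeriv_sum {ι : Type*} {t : Fin d → ℂ} (m : Fin d → ℕ) (s : Finset ι)
    {f : ι → (Fin d → ℂ) → ℂ} (hf : ∀ i, AnalyticAt ℂ (f i) t) :
    multiPartialDeriv m (fun r => ∑ i ∈ s, f i r) t = ∑ i ∈ s, multiPartialDeriv m (f i) t := by
  classical
  induction s using Finset.induction_on with
  | empty =>
    simpa using multiPartialDeriv_const_mul m 0 (analyticAt_const (v := (0 : ℂ)) (x := t))
  | insert i s hi ih =>
    simp only [Finset.sum_insert hi]
    rw [multiPartialDeriv_add m (hf i) (Finset.analyticAt_fun_sum s fun j _ => hf j), ih]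

lemma analyticAt_coord (j : Fin d) (t : Fin d → ℂ) : AnalyticAt ℂ (fun s : Fin d → ℂ => s j) t :=
  (ContinuousLinearMap.proj (R := ℂ) (φ := fun _ : Fin d => ℂ) j).analyticAt t

/-- Multiplication by a coordinate lowers the index of a derivative at the origin. The index
`m - vⱼ` is truncated when `mⱼ = 0`, where the factor `mⱼ` vanishes. -/
lemma multiPartialDeriv_coord_mul (m : Fin d → ℕ) (j : Fin d) (hF : AnalyticAt ℂ F 0) :
    multiPartialDeriv m (fun s => s j * F s) 0 =
      m j * multiPartialDeriv (m - Pi.single j 1) F 0 := by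
  induction m using multiIndex_induction generalizing F with
  | zero => simp [multiPartialDeriv_zero]
  | add_single m i ih =>
    have hx := analyticAt_coord j (0 : Fin d → ℂ)
    rw [← multiPartialDeriv_partialDeriv m i (hx.fun_mul hF),
      multiPartialDeriv_congr m (partialDeriv_coord_mul i j hF),
      multiPartialDeriv_add m (hx.fun_mul (hF.partialDeriv i)) (analyticAt_const.fun_mul hF),
      ih (hF.partialDeriv i), multiPartialDeriv_const_mul m _ hF,
      multiPartialDeriv_partialDeriv _ i hF]
    by_cases hij : i = j
    · subst hij
      rw [add_tsub_cancel_right]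
      by_cases h0 : m i = 0
      · simp [h0]
      · rw [sub_single_add_single h0]
        simp
        ring
    · have hm : m - Pi.single j 1 + Pi.single i 1 = m + Pi.single i 1 - Pi.single j 1 := by
        funext l
        by_cases hl : l = i
        · subst hl; simp [hij]
        · simp [hl]
      rw [hm]
      simp [hij, Ne.symm hij]

end PartialDeriv

/-! ### The generating function -/

section GeneratingFunction

variable {d : ℕ}

lemma analyticAt_one_sub_linear_cpow (u : Fin d → ℂ) (z : ℂ) {t : Fin d → ℂ}
    (ht : 1 - ∑ j, u j * t j ∈ Complex.slitPlane) :
    AnalyticAt ℂ (fun s : Fin d → ℂ => (1 - ∑ j, u j * s j) ^ z) t :=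
  AnalyticAt.cpow (analyticAt_const.fun_sub (Finset.analyticAt_fun_sum _ fun j _ =>
    analyticAt_const.fun_mul (analyticAt_coord j t))) analyticAt_const ht

lemma hasFDerivAt_one_sub_linear_cpow (u : Fin d → ℂ) (z : ℂ) {t : Fin d → ℂ}
    (ht : 1 - ∑ j, u j * t j ∈ Complex.slitPlane) :
    ∃ L : (Fin d → ℂ) →L[ℂ] ℂ,
      HasFDerivAt (fun s : Fin d → ℂ => (1 - ∑ j, u j * s j) ^ z) L t ∧
      ∀ i, L (Pi.single i 1) =
        (1 - ∑ j, u j * t j) ^ z * (-(z * u i) / (1 - ∑ j, u j * t j)) := by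
  have h0 : 1 - ∑ j, u j * t j ≠ 0 := Complex.slitPlane_ne_zero ht
  have hlin : HasFDerivAt (fun s : Fin d → ℂ => 1 - ∑ j, u j * s j)
      (-∑ j, u j • ContinuousLinearMap.proj (R := ℂ) (φ := fun _ : Fin d => ℂ) j) t := by
    refine (HasFDerivAt.fun_sum fun j _ => ?_).const_sub 1
    exact (ContinuousLinearMap.proj (R := ℂ) (φ := fun _ : Fin d => ℂ) j).hasFDerivAt.const_mul
      (u j)
  refine ⟨_, hlin.cpow (hasFDerivAt_const z t) ht, fun i => ?_⟩
  rw [Complex.cpow_sub _ _ h0, Complex.cpow_one]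
  simp [Pi.single_apply]
  ring

lemma eventually_one_sub_linear_mem_slitPlane (u : Fin d → ℂ) :
    ∀ᶠ t in 𝓝 (0 : Fin d → ℂ), 1 - ∑ j, u j * t j ∈ Complex.slitPlane := by
  have hc : Continuous fun t : Fin d → ℂ => 1 - ∑ j, u j * t j := by fun_prop
  exact hc.continuousAt.eventually_mem (Complex.isOpen_slitPlane.mem_nhds (by simp))

lemma analyticAt_meixnerGen (x : Fin d → ℂ) (U : Matrix (Fin d) (Fin d) ℂ) (β : ℂ) :
    AnalyticAt ℂ (meixnerGen x U β) 0 := by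
  unfold meixnerGen
  have h1 := analyticAt_one_sub_linear_cpow (fun _ : Fin d => 1) (-β - ∑ i, x i) (t := 0) (by simp)
  simp only [one_mul] at h1
  exact h1.fun_mul (Finset.analyticAt_fun_prod _ fun i _ =>
    analyticAt_one_sub_linear_cpow (U i) (x i) (by simp))

/-- The logarithmic derivative of the generating function. -/
lemma partialDeriv_meixnerGen (x : Fin d → ℂ) (U : Matrix (Fin d) (Fin d) ℂ) (β : ℂ)
    {t : Fin d → ℂ} (h0 : 1 - ∑ j, t j ∈ Complex.slitPlane)
    (h : ∀ l, 1 - ∑ j, U l j * t j ∈ Complex.slitPlane) (i : Fin d) :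
    partialDeriv i (meixnerGen x U β) t = meixnerGen x U β t *
      ((β + ∑ l, x l) / (1 - ∑ j, t j) - ∑ l, x l * U l i / (1 - ∑ j, U l j * t j)) := by
  obtain ⟨L0, hL0, hL0'⟩ := hasFDerivAt_one_sub_linear_cpow (fun _ : Fin d => 1)
    (-β - ∑ i, x i) (t := t) (by simpa using h0)
  simp only [one_mul] at hL0 hL0'
  choose L hL hL' using fun l => hasFDerivAt_one_sub_linear_cpow (U l) (x l) (h l)
  have hprod := hL0.fun_mul (HasFDerivAt.finsetProd (u := Finset.univ) fun l _ => hL l)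
  have hterm : ∀ l, (∏ j ∈ Finset.univ.erase l, (1 - ∑ r, U j r * t r) ^ x j) *
      L l (Pi.single i 1) = (∏ j, (1 - ∑ r, U j r * t r) ^ x j) *
        (-(x l * U l i) / (1 - ∑ j, U l j * t j)) := by
    intro l
    rw [hL', ← Finset.mul_prod_erase Finset.univ _ (Finset.mem_univ l)]
    ring
  unfold partialDeriv
  rw [show meixnerGen x U β = fun s => (1 - ∑ j, s j) ^ (-β - ∑ i, x i) *
    ∏ i, (1 - ∑ j, U i j * s j) ^ (x i) from rfl, hprod.fderiv]
  simp only [add_apply, smul_apply, sum_apply, smul_eq_mul, hterm, hL0', ← Finset.mul_sum, neg_div,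
    Finset.sum_neg_distrib]
  ring

/-- The partial differential equation in `t` behind the recurrence: with `Lₖ = ∑ⱼ Uₖⱼ tⱼ` and
`θ = ∑ⱼ tⱼ ∂ⱼ`, the operator `(1 - Lₖ) (β + θ - ∑ᵢ wᵢ ∂ᵢ)` multiplies the generating function by
`κ xₖ`. -/
lemma meixnerGen_pde (x : Fin d → ℂ) (U : Matrix (Fin d) (Fin d) ℂ) (β κ : ℂ) (w : Fin d → ℂ)
    (k : Fin d) (hw : ∑ i, w i = 1)
    (hU : ∀ l, ∑ i, w i * U l i = 1 + if l = k then κ else 0)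
    {t : Fin d → ℂ} (h0 : 1 - ∑ j, t j ∈ Complex.slitPlane)
    (h : ∀ l, 1 - ∑ j, U l j * t j ∈ Complex.slitPlane) :
    (1 - ∑ j, U k j * t j) * (β * meixnerGen x U β t
        + ∑ j, t j * partialDeriv j (meixnerGen x U β) t
        - ∑ i, w i * partialDeriv i (meixnerGen x U β) t) =
      κ * x k * meixnerGen x U β t := by
  have hS := Complex.slitPlane_ne_zero h0
  have hL := fun l => Complex.slitPlane_ne_zero (h l)
  simp only [partialDeriv_meixnerGen x U β h0 h]
  set G := meixnerGen x U β t
  -- For coefficients `v`, `∑ vᵢ ∂ᵢ G` depends only on `∑ vᵢ` and the `∑ vᵢ Uₗᵢ`.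
  have hdir : ∀ v : Fin d → ℂ, ∑ i, v i * (G * ((β + ∑ l, x l) / (1 - ∑ j, t j)
        - ∑ l, x l * U l i / (1 - ∑ j, U l j * t j))) =
      G * ((β + ∑ l, x l) / (1 - ∑ j, t j) * ∑ i, v i
        - ∑ l, x l / (1 - ∑ j, U l j * t j) * ∑ i, v i * U l i) := by
    intro v
    simp only [mul_sub, Finset.mul_sum, Finset.sum_sub_distrib]
    congr 1
    · exact Finset.sum_congr rfl fun i _ => by ring
    · rw [Finset.sum_comm]
      exact Finset.sum_congr rfl fun l _ => Finset.sum_congr rfl fun i _ => by ring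
  rw [hdir, hdir, hw]
  simp only [hU]
  have e1 : (β + ∑ l, x l) / (1 - ∑ j, t j) * ∑ j, t j =
      (β + ∑ l, x l) / (1 - ∑ j, t j) - (β + ∑ l, x l) := by
    field_simp
    ring
  have e2 : ∑ l, x l / (1 - ∑ j, U l j * t j) * ∑ i, t i * U l i =
      ∑ l, x l / (1 - ∑ j, U l j * t j) - ∑ l, x l := by
    rw [← Finset.sum_sub_distrib]
    refine Finset.sum_congr rfl fun l _ => ?_
    have hl := hL l
    rw [show ∑ i, t i * U l i = ∑ i, U l i * t i from
      Finset.sum_congr rfl fun i _ => mul_comm _ _]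
    field_simp
    ring
  have e3 : ∑ l, x l / (1 - ∑ j, U l j * t j) * (1 + if l = k then κ else 0) =
      ∑ l, x l / (1 - ∑ j, U l j * t j) + x k / (1 - ∑ j, U k j * t j) * κ := by
    simp [mul_add, Finset.sum_add_distrib]
  rw [e1, e2, e3]
  have hk := hL k
  field_simp
  ring

end GeneratingFunction

/-! ### The recurrence for the Meixner polynomials -/

section Recurrence

variable {d : ℕ}

/-- The recurrence satisfied by the derivatives at the origin of a solution of
`(1 - Lₖ) (β + θ - ∑ᵢ wᵢ ∂ᵢ) G = z G`, where `Lₖ = ∑ⱼ uⱼ tⱼ` and `θ = ∑ⱼ tⱼ ∂ⱼ`. -/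
lemma multiPartialDeriv_recurrence {G : (Fin d → ℂ) → ℂ} (hG : AnalyticAt ℂ G 0)
    (u w : Fin d → ℂ) (β z : ℂ)
    (hpde : ∀ᶠ t in 𝓝 (0 : Fin d → ℂ), (1 - ∑ j, u j * t j) * (β * G t
      + ∑ j, t j * partialDeriv j G t - ∑ i, w i * partialDeriv i G t) = z * G t)
    (m : Fin d → ℕ) :
    z * multiPartialDeriv m G 0 =
      (β + ∑ i, (m i : ℂ)) * multiPartialDeriv m G 0
      + ∑ i, ∑ j, w i * u j * m j * multiPartialDeriv (m - Pi.single j 1 + Pi.single i 1) G 0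
      - ∑ j, u j * m j * ((β + ∑ i, ((m - Pi.single j 1 : Fin d → ℕ) i : ℂ))
          * multiPartialDeriv (m - Pi.single j 1 : Fin d → ℕ) G 0)
      - ∑ i, w i * multiPartialDeriv (m + Pi.single i 1 : Fin d → ℕ) G 0 := by
  have hx := fun j => analyticAt_coord j (0 : Fin d → ℂ)
  have hP := fun i => hG.partialDeriv i
  have hθ : AnalyticAt ℂ (fun t => ∑ j, t j * partialDeriv j G t) 0 :=
    Finset.analyticAt_fun_sum _ fun j _ => (hx j).fun_mul (hP j)
  have hw : AnalyticAt ℂ (fun t => ∑ i, (-w i) * partialDeriv i G t) 0 :=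
    Finset.analyticAt_fun_sum _ fun i _ => analyticAt_const.fun_mul (hP i)
  have hE : AnalyticAt ℂ (fun t => β * G t + ∑ j, t j * partialDeriv j G t) 0 :=
    (analyticAt_const.fun_mul hG).fun_add hθ
  have hEw : AnalyticAt ℂ (fun t => (β * G t + ∑ j, t j * partialDeriv j G t)
      + ∑ i, (-w i) * partialDeriv i G t) 0 := hE.fun_add hw
  have hθm : ∀ m : Fin d → ℕ, multiPartialDeriv m (fun t => ∑ j, t j * partialDeriv j G t) 0 =
      (∑ i, (m i : ℂ)) * multiPartialDeriv m G 0 := by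
    intro m
    rw [multiPartialDeriv_sum m _ fun j => (hx j).fun_mul (hP j), Finset.sum_mul]
    refine Finset.sum_congr rfl fun j _ => ?_
    rw [multiPartialDeriv_coord_mul m j (hP j), multiPartialDeriv_partialDeriv _ j hG]
    by_cases hj : m j = 0
    · simp [hj]
    · rw [sub_single_add_single hj]
  have hEwm : ∀ m : Fin d → ℕ, multiPartialDeriv m (fun t => (β * G t
      + ∑ j, t j * partialDeriv j G t) + ∑ i, (-w i) * partialDeriv i G t) 0 =
      (β + ∑ i, (m i : ℂ)) * multiPartialDeriv m G 0
        - ∑ i, w i * multiPartialDeriv (m + Pi.single i 1 : Fin d → ℕ) G 0 := by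
    intro m
    rw [multiPartialDeriv_add m hE hw, multiPartialDeriv_add m (analyticAt_const.fun_mul hG) hθ,
      multiPartialDeriv_const_mul m β hG, hθm,
      multiPartialDeriv_sum m _ fun i => analyticAt_const.fun_mul (hP i)]
    simp only [multiPartialDeriv_const_mul m _ (hP _), multiPartialDeriv_partialDeriv m _ hG]
    simp only [neg_mul, Finset.sum_neg_distrib]
    ring
  set E : (Fin d → ℂ) → ℂ := fun t => (β * G t + ∑ j, t j * partialDeriv j G t)
    + ∑ i, (-w i) * partialDeriv i G t with hEdef
  have hpde' : (fun t => z * G t) =ᶠ[𝓝 0] fun t => E t + ∑ j, (-u j) * (t j * E t) := by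
    filter_upwards [hpde] with t ht
    have h1 : ∑ j, (-u j) * (t j * E t) = -(∑ j, u j * t j) * E t := by
      rw [neg_mul, Finset.sum_mul, ← Finset.sum_neg_distrib]
      exact Finset.sum_congr rfl fun j _ => by ring
    rw [← ht, h1]
    simp only [hEdef, neg_mul, Finset.sum_neg_distrib]
    ring
  rw [← multiPartialDeriv_const_mul m z hG, multiPartialDeriv_congr m hpde',
    multiPartialDeriv_add m hEw (Finset.analyticAt_fun_sum _ fun j _ =>
      analyticAt_const.fun_mul ((hx j).fun_mul hEw)),
    multiPartialDeriv_sum m _ fun j => analyticAt_const.fun_mul ((hx j).fun_mul hEw), hEwm]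
  simp only [multiPartialDeriv_const_mul m _ ((hx _).fun_mul hEw),
    multiPartialDeriv_coord_mul m _ hEw, hEwm]
  rw [Finset.sum_comm (γ := Fin d)]
  have hsum : ∑ j, (-u j) * (m j * ((β + ∑ i, ((m - Pi.single j 1 : Fin d → ℕ) i : ℂ))
        * multiPartialDeriv (m - Pi.single j 1 : Fin d → ℕ) G 0
        - ∑ i, w i * multiPartialDeriv (m - Pi.single j 1 + Pi.single i 1) G 0)) =
      ∑ j, ∑ i, w i * u j * m j * multiPartialDeriv (m - Pi.single j 1 + Pi.single i 1) G 0
      - ∑ j, u j * m j * ((β + ∑ i, ((m - Pi.single j 1 : Fin d → ℕ) i : ℂ))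
          * multiPartialDeriv (m - Pi.single j 1 : Fin d → ℕ) G 0) := by
    rw [← Finset.sum_sub_distrib]
    refine Finset.sum_congr rfl fun j _ => ?_
    have : ∑ i, w i * u j * m j * multiPartialDeriv (m - Pi.single j 1 + Pi.single i 1) G 0 =
        u j * m j * ∑ i, w i * multiPartialDeriv (m - Pi.single j 1 + Pi.single i 1) G 0 := by
      rw [Finset.mul_sum]
      exact Finset.sum_congr rfl fun i _ => by ring
    rw [this]
    ring
  rw [hsum]
  ring

/-- The factorials in the Taylor coefficient and in the normalization cancel. -/
lemma multiPartialDeriv_meixnerGen (m : Fin d → ℕ) (x : Fin d → ℂ)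
    (U : Matrix (Fin d) (Fin d) ℂ) {β : ℂ} (hβ : (ascPochhammer ℂ (∑ i, m i)).eval β ≠ 0) :
    multiPartialDeriv m (meixnerGen x U β) 0 =
      (ascPochhammer ℂ (∑ i, m i)).eval β * meixner m x U β := by
  have hf : ∏ i, ((m i).factorial : ℂ) ≠ 0 :=
    Finset.prod_ne_zero_iff.mpr fun i _ => Nat.cast_ne_zero.mpr (Nat.factorial_ne_zero _)
  unfold meixner taylorCoeff
  field_simp

/-- The recurrence for Meixner polynomials in general parameters: all that enters of `U` are the
values of `∑ᵢ wᵢ` and `∑ᵢ wᵢ Uₗᵢ`. -/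
theorem meixner_recurrence (x : Fin d → ℂ) (U : Matrix (Fin d) (Fin d) ℂ) (β κ : ℂ)
    (hβ : ∀ N, (ascPochhammer ℂ N).eval β ≠ 0) (w : Fin d → ℂ) (k : Fin d)
    (hw : ∑ i, w i = 1) (hU : ∀ l, ∑ i, w i * U l i = 1 + if l = k then κ else 0)
    (m : Fin d → ℕ) :
    κ * x k * meixner m x U β =
      (β + ((∑ i, m i : ℕ) : ℂ)) * meixner m x U β
      + ∑ i, ∑ j, w i * U k j * m j * meixner (m - Pi.single j 1 + Pi.single i 1) x U β
      - ∑ j, U k j * m j * meixner (m - Pi.single j 1 : Fin d → ℕ) x U β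
      - (β + ((∑ i, m i : ℕ) : ℂ)) * ∑ i, w i * meixner (m + Pi.single i 1 : Fin d → ℕ) x U β := by
  have hpde : ∀ᶠ t in 𝓝 (0 : Fin d → ℂ), (1 - ∑ j, U k j * t j) * (β * meixnerGen x U β t
      + ∑ j, t j * partialDeriv j (meixnerGen x U β) t
      - ∑ i, w i * partialDeriv i (meixnerGen x U β) t) = κ * x k * meixnerGen x U β t := by
    have h0 := eventually_one_sub_linear_mem_slitPlane (fun _ : Fin d => (1 : ℂ))
    simp only [one_mul] at h0
    filter_upwards [h0, eventually_all.mpr fun l => eventually_one_sub_linear_mem_slitPlane (U l)]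
      with t ht0 ht
    exact meixnerGen_pde x U β κ w k hw hU ht0 ht
  have hrec := multiPartialDeriv_recurrence (analyticAt_meixnerGen x U β) (U k) w β (κ * x k)
    hpde m
  simp only [← Nat.cast_sum, multiPartialDeriv_meixnerGen _ x U (hβ _)] at hrec
  set A := (ascPochhammer ℂ (∑ i, m i)).eval β with hA
  have hsum : ∀ j, m j ≠ 0 → ∑ l, (m - Pi.single j 1 : Fin d → ℕ) l + 1 = ∑ l, m l := by
    intro j hj
    rw [← sum_add_single, sub_single_add_single hj]
  have h1 : ∀ i j, w i * U k j * m j *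
        ((ascPochhammer ℂ (∑ l, (m - Pi.single j 1 + Pi.single i 1 : Fin d → ℕ) l)).eval β
          * meixner (m - Pi.single j 1 + Pi.single i 1) x U β) =
      A * (w i * U k j * m j * meixner (m - Pi.single j 1 + Pi.single i 1) x U β) := by
    intro i j
    by_cases hj : m j = 0
    · simp [hj]
    · rw [sum_add_single, hsum j hj]
      ring
  have h2 : ∀ j, U k j * m j * ((β + ((∑ i, (m - Pi.single j 1 : Fin d → ℕ) i : ℕ) : ℂ)) *
        ((ascPochhammer ℂ (∑ l, (m - Pi.single j 1 : Fin d → ℕ) l)).eval β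
          * meixner (m - Pi.single j 1 : Fin d → ℕ) x U β)) =
      A * (U k j * m j * meixner (m - Pi.single j 1 : Fin d → ℕ) x U β) := by
    intro j
    by_cases hj : m j = 0
    · simp [hj]
    · rw [hA, ← hsum j hj, ascPochhammer_succ_eval]
      ring
  have h3 : ∀ i, w i * ((ascPochhammer ℂ (∑ l, (m + Pi.single i 1 : Fin d → ℕ) l)).eval β
        * meixner (m + Pi.single i 1 : Fin d → ℕ) x U β) =
      A * ((β + ((∑ i, m i : ℕ) : ℂ)) * (w i * meixner (m + Pi.single i 1 : Fin d → ℕ) x U β)) := by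
    intro i
    rw [sum_add_single, ascPochhammer_succ_eval]
    ring
  simp only [h1, h2, h3, ← Finset.mul_sum] at hrec
  apply mul_left_cancel₀ (hβ (∑ i, m i))
  rw [← hA]
  linear_combination hrec

end Recurrence

/-! ### Pseudo-unitarity -/

namespace SU1

variable {d : ℕ}

/-- Pseudo-orthogonality of two columns of `g`. -/
lemma conj_column_mul_column (g : SU1 d) (r s : Fin (d + 1)) :
    (starRingEnd ℂ) (g.val.val 0 r) * g.val.val 0 s
      - ∑ i : Fin d, (starRingEnd ℂ) (g.val.val i.succ r) * g.val.val i.succ s =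
      lorentzJ d r s := by
  have h : g.val.valᴴ * lorentzJ d * g.val.val = lorentzJ d := g.property
  rw [← congrFun (congrFun h r) s]
  rw [Matrix.mul_apply]
  simp [lorentzJ, Matrix.mul_diagonal, Fin.sum_univ_succ, sub_eq_add_neg]

lemma U_mul_pTilde (g : SU1 d) (ha : a g ≠ 0) {k i : Fin d} (hc : c g i ≠ 0) :
    U g k i * pTilde g i = D g i k / b g k := by
  unfold U pTilde
  field_simp

/-- The weight `conj(Uₖᵢ) |p̃ᵢ|²`, with the conjugate factors collected. -/
lemma weight_eq (g : SU1 d) (ha : a g ≠ 0) {k i : Fin d} (hc : c g i ≠ 0) :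
    (starRingEnd ℂ) (U g k i) * ((‖pTilde g i‖ ^ 2 : ℝ) : ℂ) =
      (starRingEnd ℂ) (D g i k) / (starRingEnd ℂ) (b g k) * pTilde g i := by
  rw [← map_div₀, ← U_mul_pTilde g ha hc, map_mul, Complex.ofReal_pow, ← Complex.conj_mul']
  ring

/-- Pseudo-orthogonality of column `0` and column `k`. -/
lemma sum_weight (g : SU1 d) (ha : a g ≠ 0) (hb : ∀ i, b g i ≠ 0) (hc : ∀ i, c g i ≠ 0)
    (k : Fin d) :
    ∑ i, (starRingEnd ℂ) (U g k i) * ((‖pTilde g i‖ ^ 2 : ℝ) : ℂ) = 1 := by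
  have h : (starRingEnd ℂ) (b g k) * a g - ∑ i, (starRingEnd ℂ) (D g i k) * c g i = 0 := by
    have := conj_column_mul_column g k.succ 0
    rw [lorentzJ, Matrix.diagonal_apply_ne _ (Fin.succ_ne_zero k)] at this
    exact this
  have hb' : (starRingEnd ℂ) (b g k) ≠ 0 := (map_ne_zero _).mpr (hb k)
  calc _ = (∑ i, (starRingEnd ℂ) (D g i k) * c g i) / ((starRingEnd ℂ) (b g k) * a g) := by
        rw [Finset.sum_div]
        refine Finset.sum_congr rfl fun i _ => ?_
        rw [weight_eq g ha (hc i), pTilde]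
        field_simp
    _ = 1 := by rw [← sub_eq_zero.mp h, div_self (mul_ne_zero hb' ha)]

/-- Pseudo-orthogonality of the columns `k` and `l`. -/
lemma sum_weight_mul_U (g : SU1 d) (ha : a g ≠ 0) (hb : ∀ i, b g i ≠ 0) (hc : ∀ i, c g i ≠ 0)
    (k l : Fin d) :
    ∑ i, (starRingEnd ℂ) (U g k i) * ((‖pTilde g i‖ ^ 2 : ℝ) : ℂ) * U g l i =
      1 + if l = k then (((‖b g k‖ ^ 2)⁻¹ : ℝ) : ℂ) else 0 := by
  have h : (starRingEnd ℂ) (b g k) * b g l - ∑ i, (starRingEnd ℂ) (D g i k) * D g i l =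
      if l = k then -1 else 0 := by
    have := conj_column_mul_column g k.succ l.succ
    rw [lorentzJ, Matrix.diagonal_apply] at this
    simp only [Fin.succ_inj, Fin.cons_succ, eq_comm (a := k)] at this
    exact this
  have hb' : (starRingEnd ℂ) (b g k) ≠ 0 := (map_ne_zero _).mpr (hb k)
  have hl := hb l
  calc _ = (∑ i, (starRingEnd ℂ) (D g i k) * D g i l) / ((starRingEnd ℂ) (b g k) * b g l) := by
        rw [Finset.sum_div]
        refine Finset.sum_congr rfl fun i _ => ?_
        rw [weight_eq g ha (hc i), mul_assoc, mul_comm (pTilde g i), U_mul_pTilde g ha (hc i)]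
        field_simp
    _ = 1 + if l = k then (((‖b g k‖ ^ 2)⁻¹ : ℝ) : ℂ) else 0 := by
        rw [← sub_sub_cancel ((starRingEnd ℂ) (b g k) * b g l)
          (∑ i, (starRingEnd ℂ) (D g i k) * D g i l), h, sub_div,
          div_self (mul_ne_zero hb' hl)]
        by_cases hlk : l = k
        · subst hlk
          simp only [if_true, Complex.ofReal_inv, Complex.ofReal_pow, ← Complex.conj_mul']
          field_simp
          ring
        · simp [hlk]

lemma norm_sq_p₀_div_p (g : SU1 d) (ha : a g ≠ 0) (p₀ : ℂ)
    (hp₀ : ‖p₀‖ ^ 2 = (‖a g‖ ^ 2)⁻¹) (k : Fin d) :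
    ‖p₀ / p g k‖ ^ 2 = (‖b g k‖ ^ 2)⁻¹ := by
  have : ‖a g‖ ≠ 0 := norm_ne_zero_iff.mpr ha
  rw [norm_div, div_pow, hp₀, p, norm_div, div_pow]
  field_simp

end SU1

theorem mainTheorem4 (d : ℕ) (σ : ℕ) (hσ : d + 1 ≤ σ) (g : SU1 d)
    (ha : SU1.a g ≠ 0) (hb : ∀ i, SU1.b g i ≠ 0) (hc : ∀ i, SU1.c g i ≠ 0)
    (p₀ : ℂ) (hp₀ : ‖p₀‖ ^ 2 = (‖SU1.a g‖ ^ 2)⁻¹)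
    (m n : Fin d → ℕ) (k : Fin d) :
    ((‖p₀ / SU1.p g k‖ ^ 2 : ℝ) : ℂ) * (n k : ℂ) * SU1.M g σ m n =
      ((σ : ℂ) + ((∑ i, m i : ℕ) : ℂ)
          + ∑ i, ((‖SU1.U g k i * SU1.pTilde g i‖ ^ 2 : ℝ) : ℂ) * (m i : ℂ)) * SU1.M g σ m n
        + ∑ i, ∑ j ∈ Finset.univ.filter (fun j => j ≠ i),
            (starRingEnd ℂ) (SU1.U g k i) * SU1.U g k j *
              ((‖SU1.pTilde g i‖ ^ 2 : ℝ) : ℂ) * (m j : ℂ) *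
                SU1.M g σ (m - Pi.single j 1 + Pi.single i 1) n
        - ∑ i, SU1.U g k i * (m i : ℂ) * SU1.M g σ (m - Pi.single i 1) n
        - ((σ : ℂ) + ((∑ i, m i : ℕ) : ℂ)) *
            ∑ i, (starRingEnd ℂ) (SU1.U g k i) * ((‖SU1.pTilde g i‖ ^ 2 : ℝ) : ℂ) *
              SU1.M g σ (m + Pi.single i 1) n := by
  have hβ : ∀ N, (ascPochhammer ℂ N).eval (σ : ℂ) ≠ 0 := by
    intro N
    rw [← ascPochhammer_eval_cast, ne_eq, Nat.cast_eq_zero]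
    exact (ascPochhammer_pos N σ (by omega)).ne'
  have hrec := meixner_recurrence (fun i => (n i : ℂ)) (SU1.U g) (σ : ℂ)
    (((‖SU1.b g k‖ ^ 2)⁻¹ : ℝ) : ℂ) hβ
    (fun i => (starRingEnd ℂ) (SU1.U g k i) * ((‖SU1.pTilde g i‖ ^ 2 : ℝ) : ℂ)) k
    (SU1.sum_weight g ha hb hc k) (SU1.sum_weight_mul_U g ha hb hc k) m
  rw [SU1.norm_sq_p₀_div_p g ha p₀ hp₀ k]
  unfold SU1.M
  rw [hrec, add_mul ((σ : ℂ) + _), add_assoc (((σ : ℂ) + _) * _), Finset.sum_mul,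
    ← Finset.sum_add_distrib]
  congr 3
  refine Finset.sum_congr rfl fun i _ => ?_
  -- The diagonal term `j = i` of the double sum, where `m - vⱼ + vᵢ = m` unless `mᵢ = 0`.
  have hdiag : (starRingEnd ℂ) (SU1.U g k i) * ((‖SU1.pTilde g i‖ ^ 2 : ℝ) : ℂ) * SU1.U g k i *
        m i * meixner (m - Pi.single i 1 + Pi.single i 1) (fun i => (n i : ℂ)) (SU1.U g) σ =
      ((‖SU1.U g k i * SU1.pTilde g i‖ ^ 2 : ℝ) : ℂ) * m i *
        meixner m (fun i => (n i : ℂ)) (SU1.U g) σ := by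
    by_cases hi : m i = 0
    · simp [hi]
    · rw [sub_single_add_single hi, norm_mul, mul_pow, Complex.ofReal_mul,
        Complex.ofReal_pow ‖SU1.U g k i‖, ← Complex.conj_mul']
      ring
  rw [← Finset.add_sum_erase _ _ (Finset.mem_univ i), hdiag, Finset.filter_ne']
  exact congrArg _ (Finset.sum_congr rfl fun j _ => by ring)
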